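/- Let $n\geq 1$ be an integer and let $a<b$ be real numbers. Let $U_n$ be the Chebyshev polynomial of the second kind and put $$\phi_n(x)=\frac{(b-a)^n}{2^{2n}}\,U_n\!\left(\frac{2x-a-b}{b-a}\right).$$ Let $f:[a,b]\to\mathbb{R}$ be such that $f^{(n-1)}$ exists and is absolutely continuous on $[a,b]$ (derivatives at the endpoints being one-sided) and $f^{(n)}\in L^\infty([a,b])$, and put $$E_n(f)=\frac{(-1)^n}{n!}\int_a^b f^{(n)}(x)\,\phi_n(x)\,dx.$$ Then $$\int_a^b f(x)\,dx=\frac1{n!}\sum_{k=0}^{n-1}\frac{(b-a)^{k+1}(2n-k)!\,(n-k-1)!}{2^{2k+2}(2n-2k-1)!\,(k+1)!}\left[f^{(k)}(a)+(-1)^kf^{(k)}(b)\right]+E_n(f),$$ and $$|E_n(f)|\leq\frac{(b-a)^{n+1}}{2^{2n}\,n!}\,\|f^{(n)}\|_\infty ,$$ where $\|\cdot\|_\infty$ is the essential supremum norm on $[a,b]$. The estimate is sharp in the sense that the coefficient of $\|f^{(n)}\|_\infty$ cannot be reduced: for fixed $n,a,b$, if $C$ is a real number such that $|E_n(f)|\leq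 C\,\|f^{(n)}\|_\infty$ for all such $f$, then $C\geq \frac{(b-a)^{n+1}}{2^{2n}\,n!}$. -/

import Mathlib

open MeasureTheory

noncomputable section

namespace ChebyshevQuadrature

/-- The `k`-th derivative of `f` on `[a,b]` (one-sided at the endpoints). When `f^{(k-1)}` is
absolutely continuous on `[a,b]` this is its derivative at almost every point of `[a,b]`
(and `0` on the null set where that derivative does not exist). -/
def D (k : ℕ) (a b : ℝ) (f : ℝ → ℝ) : ℝ → ℝ :=
  iteratedDerivWithin k f (Set.Icc a b)

/-- `f^{(n-1)}` exists on `[a,b]` and is absolutely continuous, and `f^{(n)} ∈ L^∞([a,b])`. -/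
structure Admissible (n : ℕ) (a b : ℝ) (f : ℝ → ℝ) : Prop where
  contDiffOn : ContDiffOn ℝ ((n - 1 : ℕ) : ℕ∞) f (Set.Icc a b)
  absolutelyContinuous : AbsolutelyContinuousOnInterval (D (n - 1) a b f) a b
  memLp : MemLp (D n a b f) ⊤ (volume.restrict (Set.Icc a b))

/-- `‖f^{(n)}‖_∞`, the essential supremum of `|f^{(n)}|` over `[a,b]`. -/
def supNormD (n : ℕ) (a b : ℝ) (f : ℝ → ℝ) : ℝ :=
  (eLpNorm (D n a b f) ⊤ (volume.restrict (Set.Icc a b))).toReal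

/-- The monic polynomial `((b-a)/2)^n 2^{-n} U_n((2x-a-b)/(b-a))`, with `U_n` the Chebyshev
polynomial of the second kind. -/
def phi (n : ℕ) (a b x : ℝ) : ℝ :=
  ((b - a) / 2) ^ n *
    ((2 : ℝ) ^ n)⁻¹ * (Polynomial.Chebyshev.U ℝ (n : ℤ)).eval ((2 * x - a - b) / (b - a))

/-- The quadrature rule. -/
def rule (n : ℕ) (a b : ℝ) (f : ℝ → ℝ) : ℝ :=
  1 / (n.factorial : ℝ) * ∑ k ∈ Finset.range n,
    ((b - a) ^ (k + 1) * ((2 * n - k).factorial : ℝ) * ((n - k - 1).factorial : ℝ) /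
      ((2 : ℝ) ^ (2 * k + 2) * ((2 * n - 2 * k - 1).factorial : ℝ) * ((k + 1).factorial : ℝ))) *
    (D k a b f a + (-1) ^ k * D k a b f b)

/-- The error term `E_n(f)`. -/
def errorTerm (n : ℕ) (a b : ℝ) (f : ℝ → ℝ) : ℝ :=
  (-1) ^ n / (n.factorial : ℝ) * ∫ x in a..b, D n a b f x * phi n a b x

end ChebyshevQuadrature

end

namespace ChebyshevQuadrature

open Polynomial

/-! The polynomial `phi` is monic of degree n, so its n-th derivative is n!. Integrating f · φ⁽ⁿ⁾ by
parts n times therefore turns n!∫f into boundary terms plus (-1)ⁿ∫f⁽ⁿ⁾φ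
(`Admissible.integral_mul_iterate_derivative`); the weights of the rule are the derivatives of U_n
at ±1. The estimate is Hölder's inequality with the L¹ norm of φ (`integral_abs_phi`). It is sharp
because f⁽ⁿ⁾ may be any continuous function, in particular one close to the sign of φ
(`exists_admissible_errorTerm_ge`). -/

theorem iterate_derivative_comp_linear {R : Type*} [CommRing R] (p : R[X]) (c d : R) (k : ℕ) :
    derivative^[k] (p.comp (C c * X + C d)) =
      C (c ^ k) * (derivative^[k] p).comp (C c * X + C d) := by
  induction k with
  | zero => simp
  | succ k ih =>
    rw [Function.iterate_succ_apply', ih, Function.iterate_succ_apply', derivative_C_mul,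
      derivative_comp, pow_succ, C_mul]
    simp only [derivative_add, derivative_C_mul, derivative_X, derivative_C]
    ring

theorem iterate_derivative_U_eval_neg_one (n j : ℕ) :
    (derivative^[j] (Chebyshev.U ℝ n)).eval (-1) =
      (-1) ^ (n + j) * (derivative^[j] (Chebyshev.U ℝ n)).eval 1 := by
  have hU : (Chebyshev.U ℝ n).comp (C (-1) * X + C 0) = C ((-1) ^ n) * Chebyshev.U ℝ n := by
    refine Polynomial.funext fun x => ?_
    have h := Chebyshev.U_eval_neg ℝ n x
    simp only [eval_comp, eval_add, eval_mul, eval_C, eval_X, neg_mul, one_mul, add_zero, h]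
    simp [Int.negOnePow_def]
  have h := congrArg (fun q : ℝ[X] => (derivative^[j] q).eval 1) hU
  simp only [iterate_derivative_comp_linear, iterate_derivative_C_mul, eval_mul, eval_C,
    eval_comp, eval_add, eval_X, mul_one, add_zero] at h
  rw [pow_add, mul_right_comm, ← h, mul_right_comm, ← mul_pow]
  simp

theorem iterate_derivative_U_self (n : ℕ) :
    derivative^[n] (Chebyshev.U ℝ n) = C (2 ^ n * (n.factorial : ℝ)) := by
  have hdeg : (derivative^[n] (Chebyshev.U ℝ n)).natDegree = 0 := by
    have := natDegree_iterate_derivative (Chebyshev.U ℝ n) n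
    rw [Chebyshev.natDegree_U_natCast] at this
    omega
  rw [eq_C_of_natDegree_eq_zero hdeg, coeff_iterate_derivative, zero_add,
    Nat.descFactorial_self]
  have hl := Chebyshev.leadingCoeff_U_natCast ℝ n
  rw [leadingCoeff, Chebyshev.natDegree_U_natCast] at hl
  rw [hl, nsmul_eq_mul, mul_comm]

/-- The differential equation of U_n, differentiated m times at x = 1, gives (2m+3) U⁽ᵐ⁺¹⁾(1) =
(n-m)(n+m+2) U⁽ᵐ⁾(1); the closed form is its solution starting from U_n(1) = n+1. -/
theorem iterate_derivative_U_eval_one_factorial (n m : ℕ) (hm : m ≤ n) :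
    (derivative^[m] (Chebyshev.U ℝ n)).eval 1 =
      2 ^ m * (m.factorial : ℝ) * ((n + 1 + m).factorial : ℝ) /
        (((2 * m + 1).factorial : ℝ) * ((n - m).factorial : ℝ)) := by
  induction m with
  | zero =>
    have : (n.factorial : ℝ) ≠ 0 := by positivity
    simp [Nat.factorial_succ]
    field_simp
  | succ m ih =>
    have hr := Chebyshev.iterate_derivative_U_eval_one_recurrence (R := ℝ) n m
    rw [ih (by omega)] at hr
    obtain ⟨l, rfl⟩ : ∃ l, n = m + 1 + l := ⟨n - (m + 1), by omega⟩
    have e1 : m + 1 + l - m = l + 1 := by omega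
    have e2 : m + 1 + l - (m + 1) = l := by omega
    have e3 : 2 * (m + 1) + 1 = (2 * m + 1) + 1 + 1 := by ring
    rw [e1] at hr
    rw [e2, e3, ← add_assoc (m + 1 + l + 1) m 1]
    have h3 : (2 * (m : ℝ) + 3) ≠ 0 := by positivity
    apply mul_left_cancel₀ h3
    rw [hr]
    have a1 : (l.factorial : ℝ) ≠ 0 := by positivity
    have a2 : ((2 * m + 1).factorial : ℝ) ≠ 0 := by positivity
    simp only [Nat.factorial_succ (2 * m + 1 + 1), Nat.factorial_succ (2 * m + 1),
      Nat.factorial_succ l, Nat.factorial_succ m, Nat.factorial_succ (m + 1 + l + 1 + m)]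
    push_cast
    field_simp
    ring

/-! ### Endpoint derivatives of φ -/

/-- `phi n a b` as a polynomial. -/
noncomputable def phiPoly (n : ℕ) (a b : ℝ) : ℝ[X] :=
  C (((b - a) / 2) ^ n * ((2 : ℝ) ^ n)⁻¹) *
    (Chebyshev.U ℝ n).comp (C (2 / (b - a)) * X + C (-(a + b) / (b - a)))

theorem iterate_derivative_phiPoly_eval (n : ℕ) (a b : ℝ) (j : ℕ) (x : ℝ) :
    (derivative^[j] (phiPoly n a b)).eval x =
      ((b - a) / 2) ^ n * ((2 : ℝ) ^ n)⁻¹ * (2 / (b - a)) ^ j *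
        (derivative^[j] (Chebyshev.U ℝ n)).eval ((2 * x - a - b) / (b - a)) := by
  rw [phiPoly, iterate_derivative_C_mul, iterate_derivative_comp_linear]
  simp only [eval_mul, eval_C, eval_comp, eval_add, eval_X]
  rw [show 2 / (b - a) * x + -(a + b) / (b - a) = (2 * x - a - b) / (b - a) by ring]
  ring

theorem phiPoly_eval (n : ℕ) (a b x : ℝ) : (phiPoly n a b).eval x = phi n a b x := by
  simpa [phi] using iterate_derivative_phiPoly_eval n a b 0 x

theorem continuous_phi (n : ℕ) (a b : ℝ) : Continuous (phi n a b) := by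
  simpa [phiPoly_eval] using (phiPoly n a b).continuous

theorem iterate_derivative_phiPoly_self (n : ℕ) {a b : ℝ} (hab : a < b) (x : ℝ) :
    (derivative^[n] (phiPoly n a b)).eval x = n.factorial := by
  have h : b - a ≠ 0 := by linarith
  rw [iterate_derivative_phiPoly_eval, iterate_derivative_U_self, eval_C,
    div_pow, div_pow]
  field_simp

theorem iterate_derivative_phiPoly_right (n k : ℕ) (hk : k < n) {a b : ℝ} (hab : a < b) :
    (derivative^[n - 1 - k] (phiPoly n a b)).eval b =
      (b - a) ^ (k + 1) * ((2 * n - k).factorial : ℝ) * ((n - k - 1).factorial : ℝ) /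
      ((2 : ℝ) ^ (2 * k + 2) * ((2 * n - 2 * k - 1).factorial : ℝ) *
        ((k + 1).factorial : ℝ)) := by
  have h : b - a ≠ 0 := by linarith
  obtain ⟨m, rfl⟩ : ∃ m, n = m + k + 1 := ⟨n - k - 1, by omega⟩
  rw [iterate_derivative_phiPoly_eval, show 2 * b - a - b = b - a by ring, div_self h,
    show m + k + 1 - 1 - k = m by omega,
    iterate_derivative_U_eval_one_factorial _ _ (by omega),
    show 2 * (m + k + 1) - k = m + k + 1 + 1 + m by omega,
    show m + k + 1 - k - 1 = m by omega, show 2 * (m + k + 1) - 2 * k - 1 = 2 * m + 1 by omega,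
    show m + k + 1 - m = k + 1 by omega]
  have a1 : ((k + 1).factorial : ℝ) ≠ 0 := by positivity
  have a2 : ((2 * m + 1).factorial : ℝ) ≠ 0 := by positivity
  rw [div_pow, div_pow]
  field_simp
  ring

theorem iterate_derivative_phiPoly_left (n k : ℕ) (hk : k < n) {a b : ℝ} (hab : a < b) :
    (derivative^[n - 1 - k] (phiPoly n a b)).eval a =
      (-1) ^ (k + 1) * (derivative^[n - 1 - k] (phiPoly n a b)).eval b := by
  have h : b - a ≠ 0 := by linarith
  rw [iterate_derivative_phiPoly_eval, iterate_derivative_phiPoly_eval,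
    show 2 * b - a - b = b - a by ring, show 2 * a - a - b = -(b - a) by ring, neg_div,
    div_self h, iterate_derivative_U_eval_neg_one]
  obtain ⟨m, rfl⟩ : ∃ m, n = m + k + 1 := ⟨n - k - 1, by omega⟩
  rw [show m + k + 1 - 1 - k = m by omega,
    show m + k + 1 + m = 2 * m + (k + 1) by ring, pow_add (-1 : ℝ), pow_mul]
  ring

/-! ### The L¹ norm of φ -/

theorem integral_abs_sin_nat_mul_pi (m : ℕ) :
    ∫ x in (0 : ℝ)..m * Real.pi, |Real.sin x| = 2 * m := by
  have hper : Function.Periodic (fun x => |Real.sin x|) Real.pi := fun x => by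
    simp [Real.sin_add_pi]
  have h0 : ∫ x in (0 : ℝ)..Real.pi, |Real.sin x| = 2 := by
    rw [intervalIntegral.integral_congr (g := Real.sin) fun x hx => ?_, integral_sin]
    · norm_num
    · rw [Set.uIcc_of_le Real.pi_pos.le] at hx
      exact abs_of_nonneg (Real.sin_nonneg_of_mem_Icc hx)
  have h := hper.intervalIntegral_add_zsmul_eq m 0
    (fun t s => (Real.continuous_sin.abs).intervalIntegrable t s)
  simp only [zero_add, h0] at h
  simpa [mul_comm] using h

theorem integral_abs_sin_succ_mul (n : ℕ) :
    ∫ θ in (0 : ℝ)..Real.pi, |Real.sin (((n : ℝ) + 1) * θ)| = 2 := by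
  have h : ((n : ℝ) + 1) ≠ 0 := by positivity
  rw [intervalIntegral.integral_comp_mul_left (fun x => |Real.sin x|) h]
  have := integral_abs_sin_nat_mul_pi (n + 1)
  push_cast at this
  rw [mul_zero, this, smul_eq_mul]
  field_simp

/-- Under x = (a+b)/2 + ((b-a)/2) cos θ the Jacobian supplies the factor sin θ in U_n(cos θ) sin θ =
sin((n+1)θ). -/
theorem integral_abs_phi (n : ℕ) {a b : ℝ} (hab : a < b) :
    ∫ x in a..b, |phi n a b x| = (b - a) ^ (n + 1) / (2 : ℝ) ^ (2 * n) := by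
  have h : 0 < b - a := by linarith
  have hsub := intervalIntegral.integral_comp_mul_deriv (a := Real.pi) (b := 0)
    (f := fun θ => (a + b) / 2 + (b - a) / 2 * Real.cos θ)
    (f' := fun θ => (b - a) / 2 * -Real.sin θ) (g := fun x => |phi n a b x|)
    (fun x _ => ((Real.hasDerivAt_cos x).const_mul _).const_add _)
    (by fun_prop) (continuous_phi n a b).abs
  simp only [Real.cos_pi, Real.cos_zero] at hsub
  rw [show (a + b) / 2 + (b - a) / 2 * -1 = a by ring,
    show (a + b) / 2 + (b - a) / 2 * 1 = b by ring] at hsub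
  rw [← hsub, intervalIntegral.integral_symm, ← intervalIntegral.integral_neg]
  have hpt : ∀ θ ∈ Set.uIcc 0 Real.pi,
      -(((fun x => |phi n a b x|) ∘ fun θ => (a + b) / 2 + (b - a) / 2 * Real.cos θ) θ *
        ((b - a) / 2 * -Real.sin θ)) =
      ((b - a) / 2) ^ (n + 1) * ((2 : ℝ) ^ n)⁻¹ * |Real.sin (((n : ℝ) + 1) * θ)| := by
    intro θ hθ
    rw [Set.uIcc_of_le Real.pi_pos.le] at hθ
    have hs := Real.sin_nonneg_of_mem_Icc hθ
    have hU := Polynomial.Chebyshev.U_real_cos θ (n : ℤ)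
    push_cast at hU
    rw [← hU, abs_mul, abs_of_nonneg hs]
    simp only [Function.comp, phi]
    rw [show (2 * ((a + b) / 2 + (b - a) / 2 * Real.cos θ) - a - b) / (b - a) = Real.cos θ by
      field_simp; ring, abs_mul, abs_of_nonneg (by positivity)]
    ring
  rw [intervalIntegral.integral_congr hpt, intervalIntegral.integral_const_mul,
    integral_abs_sin_succ_mul]
  rw [div_pow]
  field_simp
  ring

/-! ### Integration by parts and the error bound -/

section

variable {n : ℕ} {a b : ℝ} {f : ℝ → ℝ}

theorem Admissible.absolutelyContinuousOnInterval_D (hab : a < b) (hf : Admissible n a b f)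
    {k : ℕ} (hk : k < n) : AbsolutelyContinuousOnInterval (D k a b f) a b := by
  rcases (Nat.le_sub_one_of_lt hk).eq_or_lt with rfl | hlt
  · exact hf.absolutelyContinuous
  · have h1 : ContDiffOn ℝ (k + 1 : ℕ) f (Set.Icc a b) :=
      hf.contDiffOn.of_le (by exact_mod_cast hlt)
    have h2 := (contDiffOn_nat_succ_iff_contDiffOn_one_iteratedDerivWithin
      (uniqueDiffOn_Icc hab)).1 h1
    apply ContDiffOn.absolutelyContinuousOnInterval
    rw [Set.uIcc_of_le hab.le]
    exact h2.2

theorem deriv_D {k : ℕ} {x : ℝ} (hx : x ∈ Set.Ioo a b) :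
    deriv (D k a b f) x = D (k + 1) a b f x := by
  rw [D, D, iteratedDerivWithin_succ, derivWithin_of_mem_nhds (Icc_mem_nhds hx.1 hx.2)]

theorem Admissible.integral_D_mul_derivative (hab : a < b) (hf : Admissible n a b f)
    {k : ℕ} (hk : k < n) (p : ℝ[X]) :
    ∫ x in a..b, D k a b f x * (derivative p).eval x =
      D k a b f b * p.eval b - D k a b f a * p.eval a -
        ∫ x in a..b, D (k + 1) a b f x * p.eval x := by
  have hp : AbsolutelyContinuousOnInterval (fun x => p.eval x) a b :=
    ((by simpa [coe_aeval_eq_eval] using p.contDiff_aeval (𝕜 := ℝ) 1 :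
      ContDiff ℝ 1 fun x => p.eval x).contDiffOn).absolutelyContinuousOnInterval
  have h := (hf.absolutelyContinuousOnInterval_D hab hk).integral_mul_deriv_eq_deriv_mul hp
  simp only [Polynomial.deriv] at h
  rw [h]
  congr 1
  -- The two-sided and one-sided derivatives are only compared in the open interval; the endpoints
  -- are null.
  refine intervalIntegral.integral_congr_uIoo fun x hx => ?_
  rw [Set.uIoo_of_le hab.le] at hx
  simp only [deriv_D hx]

theorem Admissible.integral_mul_iterate_derivative (hab : a < b) (hf : Admissible n a b f)
    (p : ℝ[X]) {m : ℕ} (hm : m ≤ n) :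
    ∫ x in a..b, f x * (derivative^[n] p).eval x =
      ∑ k ∈ Finset.range m, (-1) ^ k * (D k a b f b * (derivative^[n - 1 - k] p).eval b -
        D k a b f a * (derivative^[n - 1 - k] p).eval a) +
      (-1) ^ m * ∫ x in a..b, D m a b f x * (derivative^[n - m] p).eval x := by
  induction m with
  | zero => simp [D]
  | succ m ih =>
    rw [ih (by omega), Finset.sum_range_succ, show n - m = (n - 1 - m) + 1 by omega,
      Function.iterate_succ_apply', hf.integral_D_mul_derivative hab hm,
      show n - (m + 1) = n - 1 - m by omega]
    ring

theorem Admissible.integral_eq (hab : a < b) (hf : Admissible n a b f) :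
    ∫ x in a..b, f x = rule n a b f + errorTerm n a b f := by
  have h := hf.integral_mul_iterate_derivative hab (phiPoly n a b) le_rfl
  have hn : (n.factorial : ℝ) ≠ 0 := by positivity
  simp only [iterate_derivative_phiPoly_self n hab, Nat.sub_self, Function.iterate_zero, id,
    phiPoly_eval, intervalIntegral.integral_mul_const] at h
  rw [← eq_div_iff hn] at h
  rw [h, rule, errorTerm, add_div, one_div_mul_eq_div, div_mul_eq_mul_div]
  congr 2
  refine Finset.sum_congr rfl fun k hk => ?_
  have hk := Finset.mem_range.1 hk
  rw [iterate_derivative_phiPoly_left n k hk hab, ← iterate_derivative_phiPoly_right n k hk hab]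
  -- At a, the sign (-1)^k from the parts and (-1)^(k+1) from the parity of φ leave a minus, which
  -- cancels the minus of the lower limit.
  have hs : ((-1 : ℝ) ^ k) * (-1) ^ k = 1 := by rw [← mul_pow]; simp
  rw [pow_succ]
  linear_combination (D k a b f a * (derivative^[n - 1 - k] (phiPoly n a b)).eval b) * hs

theorem Admissible.abs_errorTerm_le (hab : a < b) (hf : Admissible n a b f) :
    |errorTerm n a b f| ≤
      (b - a) ^ (n + 1) / ((2 : ℝ) ^ (2 * n) * (n.factorial : ℝ)) * supNormD n a b f := by
  have hae : ∀ᵐ x, x ∈ Set.Ioc a b → ‖D n a b f x * phi n a b x‖ ≤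
      supNormD n a b f * |phi n a b x| := by
    have h := ae_le_eLpNormEssSup (f := D n a b f) (μ := volume.restrict (Set.Icc a b))
    rw [ae_restrict_iff' measurableSet_Icc] at h
    filter_upwards [h] with x hx hxm
    have hx := hx (Set.Ioc_subset_Icc_self hxm)
    rw [norm_mul, Real.norm_eq_abs (phi n a b x)]
    refine mul_le_mul_of_nonneg_right ?_ (abs_nonneg _)
    rw [supNormD, eLpNorm_exponent_top, ← toReal_enorm]
    exact ENNReal.toReal_mono (by simpa using hf.memLp.2.ne) hx
  have h := intervalIntegral.norm_integral_le_of_norm_le hab.le hae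
    ((continuous_const.mul (continuous_phi n a b).abs).intervalIntegrable a b)
  rw [intervalIntegral.integral_const_mul, integral_abs_phi n hab, Real.norm_eq_abs] at h
  rw [errorTerm, abs_mul, abs_div, abs_pow, abs_neg, abs_one, one_pow,
    Nat.abs_cast]
  calc 1 / (n.factorial : ℝ) * |∫ x in a..b, D n a b f x * phi n a b x|
      ≤ 1 / (n.factorial : ℝ) * (supNormD n a b f * ((b - a) ^ (n + 1) / 2 ^ (2 * n))) := by
        gcongr
    _ = _ := by field_simp

end

/-! ### Sharpness -/

theorem exists_iteratedDeriv_eq (n : ℕ) {g : ℝ → ℝ} (hg : Continuous g) :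
    ∃ f : ℝ → ℝ, ContDiff ℝ n f ∧ iteratedDeriv n f = g := by
  induction n with
  | zero => exact ⟨g, by simpa using contDiff_zero (𝕜 := ℝ).2 hg, by simp⟩
  | succ n ih =>
    obtain ⟨F, hF, hFg⟩ := ih
    have hd : ∀ x, HasDerivAt (fun x => ∫ t in (0 : ℝ)..x, F t) (F x) x := fun x =>
      intervalIntegral.integral_hasDerivAt_right (hF.continuous.intervalIntegrable _ _)
        (hF.continuous.stronglyMeasurableAtFilter _ _) hF.continuous.continuousAt
    have hd' : _root_.deriv (fun x => ∫ t in (0 : ℝ)..x, F t) = F := funext fun x => (hd x).deriv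
    refine ⟨fun x => ∫ t in (0 : ℝ)..x, F t, ?_, ?_⟩
    · push_cast
      rw [contDiff_succ_iff_deriv, hd']
      exact ⟨fun x => (hd x).differentiableAt, by simp, hF⟩
    · rw [iteratedDeriv_succ', hd', hFg]

theorem exists_admissible_D_eq {n : ℕ} (hn : 1 ≤ n) {a b : ℝ} (hab : a < b) {g : ℝ → ℝ}
    (hg : Continuous g) :
    ∃ f : ℝ → ℝ, Admissible n a b f ∧ ∀ x ∈ Set.Icc a b, D n a b f x = g x := by
  obtain ⟨f, hf, hfg⟩ := exists_iteratedDeriv_eq n hg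
  have hD : ∀ x ∈ Set.Icc a b, D n a b f x = g x := fun x hx => by
    rw [D, iteratedDerivWithin_eq_iteratedDeriv (uniqueDiffOn_Icc hab) hf.contDiffAt hx, hfg]
  obtain ⟨m, rfl⟩ : ∃ m, n = m + 1 := ⟨n - 1, by omega⟩
  refine ⟨f, ⟨?_, ?_, ?_⟩, hD⟩
  · exact hf.contDiffOn.of_le (by exact_mod_cast Nat.sub_le _ _)
  · have h2 := (contDiffOn_nat_succ_iff_contDiffOn_one_iteratedDerivWithin
      (uniqueDiffOn_Icc hab)).1 (hf.contDiffOn (s := Set.Icc a b))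
    apply ContDiffOn.absolutelyContinuousOnInterval
    rw [Set.uIcc_of_le hab.le]
    exact h2.2
  · obtain ⟨M, hM⟩ := isCompact_Icc.exists_bound_of_continuousOn (s := Set.Icc a b) hg.continuousOn
    have hgm : MemLp g ⊤ (volume.restrict (Set.Icc a b)) :=
      memLp_top_of_bound hg.aestronglyMeasurable M
        ((ae_restrict_iff' measurableSet_Icc).2 (Filter.Eventually.of_forall hM))
    exact (memLp_congr_ae ((ae_restrict_iff' measurableSet_Icc).2
      (Filter.Eventually.of_forall hD))).2 hgm

/-- The continuous substitute φ/(|φ|+ε) for the sign of φ costs at most ε pointwise: φ²/(|φ|+ε) ≥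
|φ| - ε. -/
theorem exists_admissible_errorTerm_ge {n : ℕ} (hn : 1 ≤ n) {a b : ℝ} (hab : a < b) {ε : ℝ}
    (hε : 0 < ε) :
    ∃ f : ℝ → ℝ, Admissible n a b f ∧ supNormD n a b f ≤ 1 ∧
      (b - a) ^ (n + 1) / ((2 : ℝ) ^ (2 * n) * (n.factorial : ℝ)) -
        ε * (b - a) / (n.factorial : ℝ) ≤ |errorTerm n a b f| := by
  have hφ := continuous_phi n a b
  have hpos : ∀ x, 0 < |phi n a b x| + ε := fun x => by positivity
  have hg : Continuous fun x => phi n a b x / (|phi n a b x| + ε) :=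
    hφ.div (hφ.abs.add continuous_const) fun x => (hpos x).ne'
  obtain ⟨f, hf, hD⟩ := exists_admissible_D_eq hn hab hg
  refine ⟨f, hf, ?_, ?_⟩
  · refine ENNReal.toReal_le_of_le_ofReal zero_le_one ?_
    rw [eLpNorm_exponent_top]
    refine eLpNormEssSup_le_of_ae_bound ((ae_restrict_iff' measurableSet_Icc).2
      (Filter.Eventually.of_forall fun x hx => ?_))
    rw [hD x hx, Real.norm_eq_abs, abs_div, abs_of_pos (hpos x), div_le_one (hpos x)]
    linarith
  · have hint : (b - a) ^ (n + 1) / (2 : ℝ) ^ (2 * n) - ε * (b - a) ≤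
        ∫ x in a..b, D n a b f x * phi n a b x := by
      rw [intervalIntegral.integral_congr (g := fun x =>
        phi n a b x / (|phi n a b x| + ε) * phi n a b x) fun x hx => by
          rw [Set.uIcc_of_le hab.le] at hx; simp only [hD x hx]]
      have : ∫ x in a..b, (|phi n a b x| - ε) =
          (b - a) ^ (n + 1) / (2 : ℝ) ^ (2 * n) - ε * (b - a) := by
        rw [intervalIntegral.integral_sub (hφ.abs.intervalIntegrable _ _) (by simp),
          integral_abs_phi n hab, intervalIntegral.integral_const, smul_eq_mul, mul_comm ε]
      rw [← this]
      refine intervalIntegral.integral_mono_on hab.le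
        ((hφ.abs.sub continuous_const).intervalIntegrable _ _)
        ((hg.mul hφ).intervalIntegrable _ _) fun x _ => ?_
      rw [div_mul_eq_mul_div, le_div_iff₀ (hpos x)]
      nlinarith [abs_mul_abs_self (phi n a b x), sq_nonneg ε]
    rw [errorTerm, abs_mul, abs_div, abs_pow, abs_neg, abs_one, one_pow, Nat.abs_cast]
    have h1 := hint.trans (le_abs_self _)
    calc _ = 1 / (n.factorial : ℝ) *
          ((b - a) ^ (n + 1) / (2 : ℝ) ^ (2 * n) - ε * (b - a)) := by field_simp
      _ ≤ _ := by gcongr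

theorem le_of_abs_errorTerm_le {n : ℕ} (hn : 1 ≤ n) {a b : ℝ} (hab : a < b) {c : ℝ}
    (hc : ∀ f : ℝ → ℝ, Admissible n a b f → |errorTerm n a b f| ≤ c * supNormD n a b f) :
    (b - a) ^ (n + 1) / ((2 : ℝ) ^ (2 * n) * (n.factorial : ℝ)) ≤ c := by
  have hba : 0 < b - a := by linarith
  have hK : 0 < (b - a) ^ (n + 1) / ((2 : ℝ) ^ (2 * n) * (n.factorial : ℝ)) := by positivity
  -- Since the test functions have norm at most 1, not exactly 1, a negative c must be handled too;
  -- `max c 0` covers it until positivity of the constant excludes 0.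
  have hmax : (b - a) ^ (n + 1) / ((2 : ℝ) ^ (2 * n) * (n.factorial : ℝ)) ≤ max c 0 := by
    refine le_of_forall_pos_le_add fun δ hδ => ?_
    obtain ⟨f, hf, hS, hE⟩ := exists_admissible_errorTerm_ge hn hab
      (ε := δ * (n.factorial : ℝ) / (b - a)) (by positivity)
    have hfac : (n.factorial : ℝ) ≠ 0 := by positivity
    have h1 : δ * (n.factorial : ℝ) / (b - a) * (b - a) / (n.factorial : ℝ) = δ := by
      field_simp
    have hS0 : 0 ≤ supNormD n a b f := ENNReal.toReal_nonneg
    have h2 : c * supNormD n a b f ≤ max c 0 := by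
      calc c * supNormD n a b f ≤ max c 0 * supNormD n a b f :=
            mul_le_mul_of_nonneg_right (le_max_left _ _) hS0
        _ ≤ max c 0 * 1 := mul_le_mul_of_nonneg_left hS (le_max_right _ _)
        _ = max c 0 := mul_one _
    linarith [hc f hf]
  exact (le_max_iff.1 hmax).resolve_right (not_le.2 hK)

end ChebyshevQuadrature

theorem mainTheorem6 (n : ℕ) (hn : 1 ≤ n) (a b : ℝ) (hab : a < b) :
    (∀ f : ℝ → ℝ, ChebyshevQuadrature.Admissible n a b f →
      (∫ x in a..b, f x) =
          ChebyshevQuadrature.rule n a b f + ChebyshevQuadrature.errorTerm n a b f ∧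
        |ChebyshevQuadrature.errorTerm n a b f| ≤
          (b - a) ^ (n + 1) / ((2 : ℝ) ^ (2 * n) * (n.factorial : ℝ)) *
            ChebyshevQuadrature.supNormD n a b f) ∧
    (∀ C : ℝ,
      (∀ f : ℝ → ℝ, ChebyshevQuadrature.Admissible n a b f →
        |ChebyshevQuadrature.errorTerm n a b f| ≤ C * ChebyshevQuadrature.supNormD n a b f) →
      (b - a) ^ (n + 1) / ((2 : ℝ) ^ (2 * n) * (n.factorial : ℝ)) ≤ C) := by
  exact ⟨fun _ hf => ⟨hf.integral_eq hab, hf.abs_errorTerm_le hab⟩,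
    fun _ hC => ChebyshevQuadrature.le_of_abs_errorTerm_le hn hab hC⟩
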